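/- **Setting.** Let $\mathbb F_q$ be a finite field, $\Lambda=\mathbb F_q[T]$ and $F=\mathbb F_q((T^{-1}))$, with the absolute value $|0|=0$, $|a|=e^{\deg a}$ for $a\ne 0$, where $\deg a$ is the largest exponent of $T$ occurring in $a$. The spaces $F^d$ carry the supremum norm. $B(x;r)=\{y:\|y-x\|<r\}$, and for a ball $B=B(x;r)$ and $j\in\mathbb N$ we write $3^jB=B(x;3^jr)$. For a Radon measure $\nu$ on $F^d$, an open set $U\subseteq F^d$ and $C,\alpha,D>0$: * a function $\varphi$ with values in $F$ is *$(C,\alpha)$-good on $U$ with respect to $\nu$* if for every ball $B\subseteq U$ with center in $\operatorname{supp}\nu$ and every $\varepsilon>0$, $$\nu(\{x\in B:|\varphi(x)|<\varepsilon\})\le C\left(\frac{\varepsilon}{\|\varphi\|_{\nu,B}}\right)^{\alpha}\nu(B),\qquad \|\varphi\|_{\nu,B}=\sup_{x\in B\cap\operatorname{supp}\nu}|\varphi(x)|$$ (with $\varepsilon/0=\infty$); * $\nu$ is *$D$-Federer on $U$* if $\nu(3B)/\nu(B)\le D$ for every ball $B$ with center in $\operatorname{supp}\nu$ and $3B\subseteq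 U$. Let $G=\mathrm{SL}(n+1,F)$, $\Gamma=\mathrm{SL}(n+1,\Lambda)$, and let $\pi:G\to G/\Gamma$ be the quotient map; $G$ acts on $G/\Gamma$ by left translations. For a row vector $y\in F^n$ put $\bar\tau(y)=\pi\begin{pmatrix}1&y\\0&I_n\end{pmatrix}$. For $\varepsilon>0$ let $$K_\varepsilon=\pi\left(\{g\in G:\|gv\|\ge\varepsilon\ \text{ for all } v\in\Lambda^{n+1}\setminus\{0\}\}\right).$$ Let $\mathfrak a^+$ be the set of tuples $\mathbf t=(t_0,t_1,\dots,t_n)$ of nonnegative integers with $t_0=t_1+\dots+t_n$, let $\|\mathbf t\|=\max_i t_i$, and for $\mathbf t\in\mathfrak a^+$ put $g_{\mathbf t}=\operatorname{diag}(T^{t_0},T^{-t_1},\dots,T^{-t_n})\in G$. **Proposition 4.1.** Let $d,n\ge1$ be integers, let $C,\alpha,D>0$, and put $\tilde C=(n+1)\,C\,D^{2(n+1)}$. Let $\nu$ be a Radon measure on $F^d$, let $B$ be a ball with center in $\operatorname{supp}\nu$, put $\tilde B=3^{n+1}B$, assume that $\nu$ is $D$-Federer on $\tilde B$, and let $\mathbf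 f=(f_1,\dots,f_n):\tilde B\to F^n$ be a continuous map such that 1. every $F$-linear combination of $1,f_1,\dots,f_n$ is $(C,\alpha)$-good on $\tilde B$ with respect to $\nu$, and 2. the restrictions of $1,f_1,\dots,f_n$ to $B\cap\operatorname{supp}\nu$ are linearly independent over $F$. Then there is $s>0$ such that for all $\mathbf t\in\mathfrak a^+$ with $\|\mathbf t\|\ge s$ and all $\varepsilon$ with $0<\varepsilon\le 1/e$, $$\nu\left(\{x\in B: g_{\mathbf t}\,\bar\tau(\mathbf f(x))\notin K_\varepsilon\}\right)\le\tilde C\,\varepsilon^{\alpha}\,\nu(B).$$ -/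

import Mathlib

open MeasureTheory Metric

noncomputable section

/-- The field `F = 𝔽_q((T⁻¹))` of Laurent series in `T⁻¹` over `Fq`. The formal variable of the
underlying Mathlib Laurent series plays the role of `T⁻¹`, so `coeff i` is the coefficient of
`T⁻ⁱ`. It is a type synonym so that it carries the absolute value below and no other topology. -/
def LaurentInf (Fq : Type*) [Field Fq] : Type _ := LaurentSeries Fq

namespace LaurentInf

variable {Fq : Type*} [Field Fq]

instance instField : Field (LaurentInf Fq) := inferInstanceAs (Field (LaurentSeries Fq))

/-- The degree in `T` of a Laurent series `∑_{k ≤ k₀} a_k T ^ k` with `a_{k₀} ≠ 0`, that is `k₀`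
(and `0` for the zero series, a value that is never used). -/
def degree (a : LaurentInf Fq) : ℤ := -HahnSeries.order (show LaurentSeries Fq from a)

/-- The absolute value `|0| = 0`, `|a| = e ^ (deg a)` for `a ≠ 0`. -/
def absVal (a : LaurentInf Fq) : ℝ :=
  open Classical in if a = 0 then 0 else Real.exp (degree a)

theorem absVal_zero : absVal (0 : LaurentInf Fq) = 0 := by simp [absVal]

theorem absVal_of_ne {a : LaurentInf Fq} (ha : a ≠ 0) : absVal a = Real.exp (degree a) := by
  simp [absVal, ha]

theorem absVal_nonneg (a : LaurentInf Fq) : 0 ≤ absVal a := by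
  unfold absVal; split_ifs <;> positivity

theorem absVal_neg (a : LaurentInf Fq) : absVal (-a) = absVal a := by
  have h : degree (-a) = degree a := congrArg Neg.neg (HahnSeries.order_neg (R := Fq) (Γ := ℤ))
  by_cases ha : a = 0
  · subst ha; simp
  · rw [absVal_of_ne ha, absVal_of_ne (neg_ne_zero.mpr ha), h]

theorem absVal_add_le_max (a b : LaurentInf Fq) :
    absVal (a + b) ≤ max (absVal a) (absVal b) := by
  by_cases ha : a = 0
  · subst ha; simp
  by_cases hb : b = 0
  · subst hb; simp
  by_cases hab : a + b = 0
  · rw [hab, absVal_zero]; exact le_max_of_le_left (absVal_nonneg a)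
  have h : min (-degree a) (-degree b) ≤ -degree (a + b) := by
    have := HahnSeries.min_order_le_order_add (Γ := ℤ) (R := Fq)
      (x := (show LaurentSeries Fq from a)) (y := (show LaurentSeries Fq from b)) hab
    simp only [degree, neg_neg]
    exact this
  rw [absVal_of_ne ha, absVal_of_ne hb, absVal_of_ne hab, le_max_iff, Real.exp_le_exp,
    Real.exp_le_exp, Int.cast_le, Int.cast_le]
  rcases min_le_iff.mp h with h | h
  · left; omega
  · right; omega

theorem absVal_mul (a b : LaurentInf Fq) : absVal (a * b) = absVal a * absVal b := by
  by_cases ha : a = 0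
  · subst ha; simp [absVal_zero]
  by_cases hb : b = 0
  · subst hb; simp [absVal_zero]
  have h : degree (a * b) = degree a + degree b := by
    have := HahnSeries.order_mul (Γ := ℤ) (R := Fq)
      (x := (show LaurentSeries Fq from a)) (y := (show LaurentSeries Fq from b)) ha hb
    change -(HahnSeries.order ((show LaurentSeries Fq from a) * (show LaurentSeries Fq from b)))
      = _
    rw [this, degree, degree]; ring
  rw [absVal_of_ne ha, absVal_of_ne hb, absVal_of_ne (mul_ne_zero ha hb), h, Int.cast_add,
    Real.exp_add]

theorem eq_zero_of_absVal {a : LaurentInf Fq} (h : absVal a = 0) : a = 0 := by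
  by_contra ha
  rw [absVal_of_ne ha] at h
  exact (Real.exp_pos _).ne' h

/-- `F` as a normed field, with `‖a‖ = |a|` and the metric `|a - b|`. -/
instance instNormedField : NormedField (LaurentInf Fq) where
  __ := instField
  norm := absVal
  dist a b := absVal (-a + b)
  dist_self a := by simp [absVal_zero]
  dist_comm a b := by rw [← absVal_neg]; congr 1; ring
  dist_triangle a b c := by
    have h : -a + c = (-a + b) + (-b + c) := by ring
    rw [h]
    exact (absVal_add_le_max _ _).trans
      (max_le_add_of_nonneg (absVal_nonneg _) (absVal_nonneg _))
  eq_of_dist_eq_zero h := by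
    have := eq_zero_of_absVal h
    exact (neg_add_eq_zero.mp this)
  dist_eq _ _ := rfl
  norm_mul := absVal_mul

/-- The inclusion of the constants `Fq` in `F`. -/
def const : Fq →+* LaurentInf Fq := (HahnSeries.C : Fq →+* LaurentSeries Fq)

variable (Fq) in
/-- The element `T` of `F`. -/
def T : LaurentInf Fq := (HahnSeries.single (-1 : ℤ) (1 : Fq) : LaurentSeries Fq)

theorem T_ne_zero : T Fq ≠ 0 :=
  (HahnSeries.single_ne_zero (one_ne_zero) : HahnSeries.single (-1 : ℤ) (1 : Fq) ≠ 0)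

/-- The inclusion `Λ = 𝔽_q[T] → F`. -/
def ofPoly : Polynomial Fq →+* LaurentInf Fq := Polynomial.eval₂RingHom const (T Fq)

end LaurentInf

section Flow

variable (Fq : Type*) [Field Fq] (m n : ℕ)

/-- The group `G = SL(m + n, F)`, the coordinates being indexed by `Fin m ⊕ Fin n`. -/
abbrev GroupG : Type _ := Matrix.SpecialLinearGroup (Fin m ⊕ Fin n) (LaurentInf Fq)

/-- The subgroup `Γ = SL(m + n, Λ)` of `G`. -/
def lattGamma : Subgroup (GroupG Fq m n) :=
  (Matrix.SpecialLinearGroup.map (n := Fin m ⊕ Fin n) (LaurentInf.ofPoly (Fq := Fq))).range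

/-- The quotient `G / Γ`, on which `G` acts by left translations (`g • π h = π (g * h)`). -/
abbrev SpaceGmodGamma : Type _ := GroupG Fq m n ⧸ lattGamma Fq m n

variable {Fq m n}

/-- The quotient map `π : G → G / Γ`. -/
def projG (g : GroupG Fq m n) : SpaceGmodGamma Fq m n := QuotientGroup.mk g

/-- `τ(Y)`, the block matrix with rows `(I_m, Y)` and `(0, I_n)`. -/
def tau (Y : Matrix (Fin m) (Fin n) (LaurentInf Fq)) : GroupG Fq m n :=
  ⟨Matrix.fromBlocks 1 Y 0 1, by simp⟩

/-- `τ̄ = π ∘ τ`. -/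
def tauBar (Y : Matrix (Fin m) (Fin n) (LaurentInf Fq)) : SpaceGmodGamma Fq m n := projG (tau Y)

variable (Fq) in
/-- `K_ε = π {g ∈ G : ‖g v‖ ≥ ε for all v ∈ Λ^{m+n} ∖ {0}}`, with the supremum norm. -/
def setK (ε : ℝ) : Set (SpaceGmodGamma Fq m n) :=
  projG '' {g | ∀ v : Fin m ⊕ Fin n → Polynomial Fq, v ≠ 0 →
    ε ≤ ‖(g : Matrix (Fin m ⊕ Fin n) (Fin m ⊕ Fin n) (LaurentInf Fq)).mulVec
      (fun i => LaurentInf.ofPoly (v i))‖}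

variable (m n) in
/-- `𝔞⁺`: the tuples `t` of `m + n` nonnegative integers with
`t_1 + ⋯ + t_m = t_{m+1} + ⋯ + t_{m+n}`. -/
def aPlus : Set (Fin m ⊕ Fin n → ℕ) :=
  {t | ∑ i, t (Sum.inl i) = ∑ j, t (Sum.inr j)}

/-- The supremum norm of a tuple of nonnegative integers. -/
def tupleNorm (t : Fin m ⊕ Fin n → ℕ) : ℕ := Finset.univ.sup t

variable (Fq) in
/-- `g_t = diag(T^{t_1}, …, T^{t_m}, T^{-t_{m+1}}, …, T^{-t_{m+n}}) ∈ G` for `t ∈ 𝔞⁺`. -/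
def gFlow (t : aPlus m n) : GroupG Fq m n :=
  ⟨Matrix.diagonal (Sum.elim (fun i => LaurentInf.T Fq ^ t.1 (Sum.inl i))
      (fun j => (LaurentInf.T Fq ^ t.1 (Sum.inr j))⁻¹)), by
    have h : ∑ i, t.1 (Sum.inl i) = ∑ j, t.1 (Sum.inr j) := t.2
    rw [Matrix.det_diagonal, Fintype.prod_sum_type]
    simp only [Sum.elim_inl, Sum.elim_inr, Finset.prod_inv_distrib, Finset.prod_pow_eq_pow_sum]
    rw [h]
    exact mul_inv_cancel₀ (pow_ne_zero _ LaurentInf.T_ne_zero)⟩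

end Flow

section Good

variable {X : Type*} [PseudoMetricSpace X] [MeasurableSpace X]

/-- `‖f‖_{ν,B} = sup {|f x| : x ∈ B ∩ supp ν}`, as an extended nonnegative real. -/
def supNormOn {K : Type*} [NormedField K] (ν : Measure X) (B : Set X) (f : X → K) : ENNReal :=
  ⨆ x ∈ B ∩ ν.support, ‖f x‖ₑ

/-- `f` is `(C, α)`-good on `U` with respect to `ν`: for every ball `B ⊆ U` with centre in
`supp ν` and every `ε > 0`,
`ν {x ∈ B : |f x| < ε} ≤ C (ε / ‖f‖_{ν,B}) ^ α ν(B)`, where `ε / 0 = ∞`. -/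
def IsGood {K : Type*} [NormedField K] (C α : ℝ) (U : Set X) (ν : Measure X) (f : X → K) :
    Prop :=
  ∀ x ∈ ν.support, ∀ r : ℝ, 0 < r → ball x r ⊆ U → ∀ ε : ℝ, 0 < ε →
    ν {y | y ∈ ball x r ∧ ‖f y‖ < ε} ≤
      ENNReal.ofReal C * (ENNReal.ofReal ε / supNormOn ν (ball x r) f) ^ α * ν (ball x r)

/-- `ν` is `D`-Federer on `U`: `ν(3B) / ν(B) ≤ D` for every ball `B` with centre in `supp ν` and
`3B ⊆ U`. -/
def IsFederer (D : ℝ) (U : Set X) (ν : Measure X) : Prop :=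
  ∀ x ∈ ν.support, ∀ r : ℝ, 0 < r → ball x (3 * r) ⊆ U →
    ν (ball x (3 * r)) / ν (ball x r) ≤ ENNReal.ofReal D

end Good

/-- The `n + 1` functions `1, f₁, …, f_n`. -/
def oneAnd {X K : Type*} [One K] {n : ℕ} (f : X → Fin n → K) : Fin (n + 1) → X → K :=
  fun i x => (Fin.cons 1 (f x) : Fin (n + 1) → K) i

end

/-! The argument is the Kleinbock–Margulis quantitative nondivergence method. For fixed `t`, every
nonzero rational subspace `W` of `F^(n+1)` has a covolume `ψ W x`, the sup norm of the Plücker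
coordinates of a minimal polynomial basis of `W` after applying `g_t τ(f x)`.

Three facts are combined. Each Plücker coordinate is an `F`-linear combination of `1, f₁, …, f_n`,
hence continuous and good. If `t` is large, every `ψ W` reaches 1 on `B ∩ supp ν`
(`exists_one_le_norm_plucker_flowMatrix`): linear independence bounds such combinations from below,
and nonzero minors of polynomial vectors have norm at least 1. If `x` is marked by a flag, all
nonzero lattice vectors have norm at least `ε` at `x`
(`RationalSubspace.le_norm_mulVec_of_isMarked`).

It remains to bound the unmarked set, which is done for abstract posets in `measure_not_isMarked_le`
by induction on the number of available ranks. Around an unmarked point take the largest ball of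
radius `r / 3 ^ m` on which some `ψ s` stays below 1. On the ball three times larger every function
reaches 1, so goodness makes `ψ s < ε` rare, and the induction hypothesis handles the elements
comparable to `s`. Ultrametric balls are nested or disjoint, so the selected balls cover without
overlap, and each rank costs one factor `D`. -/

noncomputable section

/-! ### Nondivergence for posets of functions on an ultrametric space. -/

section Nondivergence

/-- If a set is covered by a pairwise disjoint family of positive-measure open subsets of a set of
finite measure, density bounds on the members of the family give a bound on the whole set. -/
theorem measure_le_mul_of_disjoint_cover {X : Type*} [TopologicalSpace X] [MeasurableSpace X]
    [OpensMeasurableSpace X] (ν : Measure X) {𝓑 : Set (Set X)} {A B : Set X} {K : ENNReal}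
    (hB : ν B ≠ ⊤) (hopen : ∀ b ∈ 𝓑, IsOpen b) (hpos : ∀ b ∈ 𝓑, ν b ≠ 0) (hsub : ∀ b ∈ 𝓑, b ⊆ B)
    (hdisj : 𝓑.PairwiseDisjoint id) (hcov : A ⊆ ⋃₀ 𝓑)
    (hden : ∀ b ∈ 𝓑, ν (A ∩ b) ≤ K * ν b) : ν A ≤ K * ν B := by
  have hsum : ∑' b : 𝓑, ν (b : Set X) ≤ ν B := by
    refine (tsum_meas_le_meas_iUnion_of_disjoint ν (As := fun b : 𝓑 => (b : Set X))
      (fun b => (hopen b b.2).measurableSet) ?_).trans (measure_mono (Set.iUnion_subset fun b => hsub b b.2))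
    intro b b' hbb'
    exact hdisj b.2 b'.2 fun h => hbb' (Subtype.ext h)
  -- Positive masses with finite sum can only be countably many.
  have hcount : 𝓑.Countable := by
    have h := Summable.countable_support_ennreal (ne_top_of_le_ne_top hB hsum)
    have hu : Function.support (fun b : 𝓑 => ν (b : Set X)) = Set.univ :=
      Set.eq_univ_of_forall fun b => hpos b b.2
    rw [hu, Set.countable_univ_iff] at h
    exact h
  calc ν A ≤ ν (⋃ b ∈ 𝓑, A ∩ b) := by
        refine measure_mono fun y hy => ?_
        obtain ⟨b, hb, hyb⟩ := hcov hy
        exact Set.mem_biUnion hb ⟨hy, hyb⟩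
    _ ≤ ∑' b : 𝓑, ν (A ∩ b) := measure_biUnion_le ν hcount _
    _ ≤ ∑' b : 𝓑, K * ν (b : Set X) := ENNReal.tsum_le_tsum fun b => hden b b.2
    _ = K * ∑' b : 𝓑, ν (b : Set X) := ENNReal.tsum_mul_left
    _ ≤ K * ν B := by gcongr

variable {X P : Type*} [PartialOrder P]

/-- A point `y` is marked for a subset `S` of a poset, with respect to functions `ψ s`, if some
chain in `S` has all values `ψ s y` in `[ε, 1]`, while `1 ≤ ψ s y` for all other members of `S`
that are comparable to the whole chain. -/
def IsMarked (ψ : P → X → ℝ) (ε : ℝ) (S : Set P) (y : X) : Prop :=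
  ∃ c ⊆ S, IsChain (· ≤ ·) c ∧ (∀ s ∈ c, ε ≤ ψ s y ∧ ψ s y ≤ 1) ∧
    ∀ s ∈ S, s ∉ c → (∀ s' ∈ c, s ≤ s' ∨ s' ≤ s) → 1 ≤ ψ s y

theorem IsMarked.of_forall_one_le {ψ : P → X → ℝ} {ε : ℝ} {S : Set P} {y : X}
    (h : ∀ s ∈ S, 1 ≤ ψ s y) : IsMarked ψ ε S y :=
  ⟨∅, Set.empty_subset _, by simp [IsChain], by simp, fun s hs _ _ => h s hs⟩

/-- This drives the induction: once `s` lies in the chain, only elements comparable to `s` are still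
constrained, so marking within those is enough. -/
theorem IsMarked.insert {ψ : P → X → ℝ} {ε : ℝ} {S : Set P} {y : X} {s : P} (hs : s ∈ S)
    (h₁ : ε ≤ ψ s y) (h₂ : ψ s y ≤ 1)
    (h : IsMarked ψ ε {s' ∈ S | s' ≠ s ∧ (s' ≤ s ∨ s ≤ s')} y) : IsMarked ψ ε S y := by
  obtain ⟨c, hcS, hc, hc₁, hc₂⟩ := h
  refine ⟨Insert.insert s c, Set.insert_subset hs fun a ha => (hcS ha).1, ?_, ?_, ?_⟩
  · exact hc.insert fun b hb _ => (hcS hb).2.2.symm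
  · rintro a (rfl | ha)
    · exact ⟨h₁, h₂⟩
    · exact hc₁ a ha
  · intro a ha hac hcomp
    rw [Set.mem_insert_iff, not_or] at hac
    exact hc₂ a ⟨ha, hac.1, hcomp s (Set.mem_insert _ _)⟩ hac.2
      fun b hb => hcomp b (Set.mem_insert_of_mem _ hb)

variable [PseudoMetricSpace X] [IsUltrametricDist X] [MeasurableSpace X] [OpensMeasurableSpace X]

/-- Quantitative nondivergence for a poset of finite rank over an ultrametric space. -/
theorem measure_not_isMarked_le (ν : Measure X) {rk : P → ℕ} (hrk : StrictMono rk)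
    (ψ : P → X → ℝ) {c D : ENNReal} (hD : 1 ≤ D) (ε : ℝ) {U : Set X}
    (hFed : ∀ x ∈ ν.support, ∀ r : ℝ, 0 < r → ball x (3 * r) ⊆ U →
      ν (ball x (3 * r)) ≤ D * ν (ball x r))
    (hcont : ∀ s, ContinuousOn (ψ s) U)
    (hgood : ∀ s, ∀ x ∈ ν.support, ∀ r : ℝ, 0 < r → ball x r ⊆ U →
      (∃ z ∈ ball x r ∩ ν.support, 1 ≤ ψ s z) →
      ν {y | y ∈ ball x r ∧ ψ s y < ε} ≤ c * ν (ball x r))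
    (k : ℕ) (R : Finset ℕ) (hR : R.card = k) (S : Set P) (hS : ∀ s ∈ S, rk s ∈ R)
    (x : X) (r : ℝ) (hr : 0 < r) (hU : ball x r ⊆ U) (hfin : ν (ball x r) ≠ ⊤)
    (hbig : ∀ s ∈ S, ∃ z ∈ ball x r ∩ ν.support, 1 ≤ ψ s z) :
    ν {y | y ∈ ball x r ∩ ν.support ∧ ¬ IsMarked ψ ε S y} ≤ k * c * D ^ k * ν (ball x r) := by
  induction k generalizing R S x r with
  | zero =>
    have : {y | y ∈ ball x r ∩ ν.support ∧ ¬ IsMarked ψ ε S y} = ∅ := by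
      refine Set.eq_empty_of_forall_notMem fun y hy => hy.2 (.of_forall_one_le fun s hs => ?_)
      have := hS s hs
      rw [Finset.card_eq_zero.mp hR] at this
      simp at this
    rw [this]
    simp
  | succ k ih =>
    set A := {y | y ∈ ball x r ∩ ν.support ∧ ¬ IsMarked ψ ε S y} with hA
    -- The least `m` with `small y m` gives the largest ball of this form around `y` on which some
    -- function stays below 1 at support points.
    let small : X → ℕ → Prop := fun y m =>
      ∃ s ∈ S, ∀ z ∈ ball y (r / 3 ^ m) ∩ ν.support, ψ s z < 1
    have hex : ∀ y ∈ A, ∃ m, small y m := by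
      intro y hy
      have : ∃ s ∈ S, ψ s y < 1 := by
        by_contra! h
        exact hy.2 (.of_forall_one_le h)
      obtain ⟨s, hs, hlt⟩ := this
      have hnhds : U ∈ nhds y := Filter.mem_of_superset (isOpen_ball.mem_nhds hy.1.1) hU
      have hev := ((hcont s).continuousAt hnhds).eventually_lt_const hlt
      obtain ⟨δ, hδ, hball⟩ := Metric.eventually_nhds_iff_ball.mp hev
      obtain ⟨m, hm⟩ := exists_pow_lt_of_lt_one (div_pos hδ hr) (by norm_num : (1 / 3 : ℝ) < 1)
      refine ⟨m, s, hs, fun z hz => hball z (ball_subset_ball ?_ hz.1)⟩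
      rw [lt_div_iff₀ hr] at hm
      rw [div_eq_mul_inv, mul_comm, ← inv_pow, ← one_div]
      exact hm.le
    classical
    let m : X → ℕ := fun y => if h : ∃ m, small y m then Nat.find h else 0
    have hm : ∀ y ∈ A, small y (m y) := by
      intro y hy
      simp only [m, dif_pos (hex y hy)]
      exact Nat.find_spec (hex y hy)
    have hmin : ∀ y ∈ A, ∀ i, small y i → m y ≤ i := by
      intro y hy i hi
      simp only [m, dif_pos (hex y hy)]
      exact Nat.find_min' _ hi
    have hpos : ∀ i : ℕ, 0 < r / 3 ^ i := fun i => by positivity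
    have hball : ∀ y ∈ A, ball y r = ball x r := fun y hy =>
      (IsUltrametricDist.ball_eq_of_mem hy.1.1).symm
    have hsubB : ∀ y ∈ A, ∀ i : ℕ, ball y (r / 3 ^ i) ⊆ ball x r := by
      intro y hy i
      rw [← hball y hy]
      exact ball_subset_ball (div_le_self hr.le (one_le_pow₀ (by norm_num)))
    -- Every point of an ultrametric ball is a centre, so points of `A` in the ball selected at `y`
    -- select that same ball.
    have hsm : ∀ y ∈ A, ∀ z ∈ A, z ∈ ball y (r / 3 ^ m y) →
        ball z (r / 3 ^ m z) = ball y (r / 3 ^ m y) := by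
      intro y hy z hz hzy
      have h₁ : m z ≤ m y := by
        refine hmin z hz _ ?_
        have := hm y hy
        simp only [small] at this ⊢
        rwa [← IsUltrametricDist.ball_eq_of_mem hzy]
      have hyz : y ∈ ball z (r / 3 ^ m z) := by
        rw [mem_ball_comm]
        refine ball_subset_ball ?_ hzy
        gcongr
        norm_num
      have h₂ : m y ≤ m z := by
        refine hmin y hy _ ?_
        have := hm z hz
        simp only [small] at this ⊢
        rwa [← IsUltrametricDist.ball_eq_of_mem hyz]
      rw [h₁.antisymm h₂, IsUltrametricDist.ball_eq_of_mem hzy]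
    refine measure_le_mul_of_disjoint_cover ν
      (𝓑 := (fun y => ball y (r / 3 ^ m y)) '' A) hfin ?_ ?_ ?_ ?_ ?_ ?_
    · rintro _ ⟨y, -, rfl⟩
      exact isOpen_ball
    · rintro _ ⟨y, hy, rfl⟩
      exact ((Measure.mem_support_iff_forall y).mp hy.1.2 _ (ball_mem_nhds y (hpos _))).ne'
    · rintro _ ⟨y, hy, rfl⟩
      exact hsubB y hy _
    · rintro _ ⟨y, hy, rfl⟩ _ ⟨z, hz, rfl⟩ hne
      simp only [Function.onFun, id]
      rcases IsUltrametricDist.ball_subset_trichotomy y z (r := r / 3 ^ m y) (s := r / 3 ^ m z)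
        with h | h | h
      · exact absurd (hsm z hz y hy (h (mem_ball_self (hpos _)))) hne
      · exact absurd (hsm y hy z hz (h (mem_ball_self (hpos _)))).symm hne
      · exact h
    · intro y hy
      exact ⟨_, ⟨y, hy, rfl⟩, mem_ball_self (hpos _)⟩
    · rintro _ ⟨y, hy, rfl⟩
      obtain ⟨s, hs, hsmall⟩ := hm y hy
      -- Since `ball y r = ball x r`, `hbig` excludes radius `r`; hence tripling the selected ball
      -- keeps it inside `ball x r`.
      have hm0 : m y ≠ 0 := by
        intro h0
        obtain ⟨z, hz, h1⟩ := hbig s hs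
        refine absurd h1 (not_le.mpr (hsmall z ?_))
        rwa [h0, pow_zero, div_one, hball y hy]
      obtain ⟨i, hi⟩ := Nat.exists_eq_succ_of_ne_zero hm0
      have hri : r / 3 ^ i = 3 * (r / 3 ^ m y) := by
        rw [hi, Nat.succ_eq_add_one, pow_succ]
        field_simp
      have hsub := hsubB y hy i
      -- By minimality of `m y`, no function stays below 1 on the tripled ball; this supplies `hbig`
      -- for the induction hypothesis.
      have hbig' : ∀ s ∈ S, ∃ z ∈ ball y (r / 3 ^ i) ∩ ν.support, 1 ≤ ψ s z := by
        by_contra! h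
        have := hmin y hy i h
        omega
      have hsubm : ball y (r / 3 ^ m y) ⊆ ball y (r / 3 ^ i) := by
        refine ball_subset_ball ?_
        rw [hri]
        linarith [hpos (m y)]
      have hIH := ih (R.erase (rk s)) (by rw [Finset.card_erase_of_mem (hS s hs), hR]; rfl)
        {s' ∈ S | s' ≠ s ∧ (s' ≤ s ∨ s ≤ s')}
        (by
          rintro s' ⟨hs', hne, hcomp⟩
          refine Finset.mem_erase.mpr ⟨?_, hS s' hs'⟩
          rcases hcomp with h | h
          · exact (hrk (lt_of_le_of_ne h hne)).ne
          · exact (hrk (lt_of_le_of_ne h hne.symm)).ne')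
        y (r / 3 ^ i) (hpos i) (hsub.trans hU) (ne_top_of_le_ne_top hfin (measure_mono hsub))
        (fun s' hs' => hbig' s' hs'.1)
      have hfed : ν (ball y (r / 3 ^ i)) ≤ D * ν (ball y (r / 3 ^ m y)) := by
        rw [hri]
        refine hFed y hy.1.2 _ (hpos _) ?_
        rw [← hri]
        exact hsub.trans hU
      -- On the small ball `ψ s ≤ 1`. If also `ε ≤ ψ s z` and `z` is marked for the elements
      -- comparable to `s`, then adding `s` to the chain marks `z`.
      have hcover : A ∩ ball y (r / 3 ^ m y) ⊆ {z | z ∈ ball y (r / 3 ^ i) ∧ ψ s z < ε} ∪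
          {z | z ∈ ball y (r / 3 ^ i) ∩ ν.support ∧
            ¬ IsMarked ψ ε {s' ∈ S | s' ≠ s ∧ (s' ≤ s ∨ s ≤ s')} z} := by
        rintro z ⟨hzA, hz⟩
        by_cases hlt : ψ s z < ε
        · exact Or.inl ⟨hsubm hz, hlt⟩
        · exact Or.inr ⟨⟨hsubm hz, hzA.1.2⟩, fun hmk => hzA.2 (hmk.insert hs (not_lt.mp hlt)
            (hsmall z ⟨hz, hzA.1.2⟩).le)⟩
      calc ν (A ∩ ball y (r / 3 ^ m y))
          ≤ c * ν (ball y (r / 3 ^ i)) + k * c * D ^ k * ν (ball y (r / 3 ^ i)) :=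
            (measure_mono hcover).trans ((measure_union_le _ _).trans (add_le_add
              (hgood s y hy.1.2 _ (hpos i) (hsub.trans hU) (hbig' s hs)) hIH))
        _ ≤ c * D ^ k * ν (ball y (r / 3 ^ i)) + k * c * D ^ k * ν (ball y (r / 3 ^ i)) := by
            gcongr
            exact le_mul_of_one_le_right' (one_le_pow₀ hD)
        _ = ((k + 1 : ℕ) : ENNReal) * c * D ^ k * ν (ball y (r / 3 ^ i)) := by
            push_cast; ring
        _ ≤ ((k + 1 : ℕ) : ENNReal) * c * D ^ k * (D * ν (ball y (r / 3 ^ m y))) := by gcongr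
        _ = ((k + 1 : ℕ) : ENNReal) * c * D ^ (k + 1) * ν (ball y (r / 3 ^ m y)) := by ring

end Nondivergence

/-! ### The absolute value on polynomials. -/

namespace LaurentInf

variable {Fq : Type*} [Field Fq]

instance instIsUltrametricDist : IsUltrametricDist (LaurentInf Fq) :=
  IsUltrametricDist.isUltrametricDist_of_forall_norm_add_le_max_norm absVal_add_le_max

theorem norm_T : ‖T Fq‖ = Real.exp 1 := by
  have h : degree (T Fq) = 1 := by
    have := HahnSeries.order_single (Γ := ℤ) (a := (-1 : ℤ)) (r := (1 : Fq)) one_ne_zero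
    simp only [degree, T]
    exact (congrArg Neg.neg this).trans (neg_neg 1)
  change absVal (T Fq) = _
  rw [absVal_of_ne T_ne_zero, h, Int.cast_one]

theorem norm_const {a : Fq} (ha : a ≠ 0) : ‖const a‖ = 1 := by
  have h0 : const a ≠ 0 := (map_ne_zero _).mpr ha
  have h : degree (const a) = 0 := by
    have := HahnSeries.order_C (Γ := ℤ) (r := a)
    exact (congrArg Neg.neg this).trans neg_zero
  change absVal (const a) = _
  rw [absVal_of_ne h0, h, Int.cast_zero, Real.exp_zero]

/-- The leading term strictly dominates the rest, so the ultrametric inequality is an equality. -/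
theorem norm_ofPoly {p : Polynomial Fq} (hp : p ≠ 0) : ‖ofPoly p‖ = Real.exp p.natDegree := by
  induction hd : p.natDegree using Nat.strong_induction_on generalizing p with
  | _ d ih =>
    have hlead : ‖ofPoly (Polynomial.C p.leadingCoeff * Polynomial.X ^ p.natDegree)‖ =
        Real.exp d := by
      have : ofPoly (Polynomial.C p.leadingCoeff * Polynomial.X ^ p.natDegree) =
          const p.leadingCoeff * T Fq ^ p.natDegree := by
        simp [ofPoly]
      rw [this, norm_mul, norm_const (Polynomial.leadingCoeff_ne_zero.mpr hp), one_mul, norm_pow,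
        norm_T, ← Real.exp_nat_mul, mul_one, hd]
    have hsplit : ofPoly p = ofPoly p.eraseLead +
        ofPoly (Polynomial.C p.leadingCoeff * Polynomial.X ^ p.natDegree) := by
      rw [← map_add, Polynomial.eraseLead_add_C_mul_X_pow]
    by_cases h0 : p.eraseLead = 0
    · rw [hsplit, h0, map_zero, zero_add, hlead]
    · have hlt : p.eraseLead.natDegree < d := by
        rcases Polynomial.eraseLead_natDegree_lt_or_eraseLead_eq_zero p with h | h
        · rwa [hd] at h
        · exact absurd h h0
      have hn := ih _ hlt h0 rfl
      have hlt' : ‖ofPoly p.eraseLead‖ <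
          ‖ofPoly (Polynomial.C p.leadingCoeff * Polynomial.X ^ p.natDegree)‖ := by
        rw [hn, hlead]
        exact Real.exp_lt_exp.mpr (by exact_mod_cast hlt)
      rw [hsplit, IsUltrametricDist.norm_add_eq_max_of_norm_ne_norm hlt'.ne,
        max_eq_right hlt'.le, hlead]

theorem one_le_norm_ofPoly {p : Polynomial Fq} (hp : p ≠ 0) : 1 ≤ ‖ofPoly p‖ := by
  rw [norm_ofPoly hp]
  exact Real.one_le_exp (by positivity)

theorem ofPoly_injective : Function.Injective (ofPoly (Fq := Fq)) := by
  rw [injective_iff_map_eq_zero]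
  intro p hp
  by_contra h
  have := one_le_norm_ofPoly h
  rw [hp, norm_zero] at this
  linarith

end LaurentInf

/-! ### Plücker coordinates over a field. -/

section Plucker

variable {K ι : Type*}

/-- The Plücker coordinates of a tuple of vectors: its maximal minors. -/
def plucker [CommRing K] {j : ℕ} (u : Fin j → ι → K) (I : Fin j → ι) : K :=
  (Matrix.of fun a b => u b (I a)).det

theorem plucker_eq_zero_of_eq [CommRing K] {j : ℕ} (u : Fin j → ι → K) {I : Fin j → ι}
    {a b : Fin j} (hab : a ≠ b) (h : I a = I b) : plucker u I = 0 :=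
  Matrix.det_zero_of_row_eq hab (by ext c; simp [h])

theorem plucker_map {R : Type*} [CommRing R] [CommRing K] (φ : R →+* K) {j : ℕ}
    (u : Fin j → ι → R) (I : Fin j → ι) :
    plucker (fun b i => φ (u b i)) I = φ (plucker u I) := by
  rw [plucker, plucker, RingHom.map_det]
  rfl

theorem plucker_linearCombination [CommRing K] {j : ℕ} (u u' : Fin j → ι → K)
    (A : Matrix (Fin j) (Fin j) K) (h : ∀ b, u' b = ∑ c, A c b • u c) :
    plucker u' = A.det • plucker u := by
  ext I
  rw [Pi.smul_apply, smul_eq_mul, plucker, plucker, mul_comm, ← Matrix.det_mul]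
  congr 1
  ext a b
  simp [Matrix.mul_apply, h, mul_comm]

theorem plucker_cons [CommRing K] {j : ℕ} (v : ι → K) (u : Fin j → ι → K) (I : Fin (j + 1) → ι) :
    plucker (Fin.cons v u) I =
      ∑ a : Fin (j + 1), (-1) ^ (a : ℕ) * v (I a) * plucker u (fun i => I (a.succAbove i)) := by
  rw [plucker, Matrix.det_succ_column_zero]
  rfl

/-- Ultrametric Hadamard inequality: expansion along the first column, with no constant because the
norm of a sum is at most the largest norm of a term. -/
theorem norm_plucker_cons_le [NormedField K] [IsUltrametricDist K] [Fintype ι] {j : ℕ}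
    (v : ι → K) (u : Fin j → ι → K) :
    ‖plucker (Fin.cons v u : Fin (j + 1) → ι → K)‖ ≤ ‖v‖ * ‖plucker u‖ := by
  refine (pi_norm_le_iff_of_nonneg (by positivity)).mpr fun I => ?_
  rw [plucker_cons]
  refine IsUltrametricDist.norm_sum_le_of_forall_le_of_nonneg (by positivity) fun a _ => ?_
  rw [norm_mul, norm_mul, norm_pow, norm_neg, norm_one, one_pow, one_mul]
  gcongr
  · exact norm_le_pi_norm v _
  · exact norm_le_pi_norm (plucker u) _

/-- If all maximal minors vanished, expanding along an added row would make the cofactors the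
coefficients of a linear relation, with a nonzero one by induction. The index type may be infinite,
so this also applies to families of functions. -/
theorem exists_plucker_ne_zero [Field K] {j : ℕ} {u : Fin j → ι → K}
    (hu : LinearIndependent K u) : ∃ I, plucker u I ≠ 0 := by
  induction j with
  | zero => exact ⟨Fin.elim0, by simp [plucker]⟩
  | succ j ih =>
    obtain ⟨I, hI⟩ := ih (u := fun b => u b.succ) (hu.comp _ (Fin.succ_injective _))
    by_contra! h
    have hzero : ∑ b : Fin (j + 1), ((-1) ^ (b : ℕ) *
        plucker (fun c => u (b.succAbove c)) I) • u b = 0 := by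
      ext i
      have := h (Fin.cons i I)
      rw [plucker, Matrix.det_succ_row_zero] at this
      rw [Finset.sum_apply, Pi.zero_apply, ← this]
      refine Finset.sum_congr rfl fun b _ => ?_
      simp only [Pi.smul_apply, smul_eq_mul, Matrix.of_apply, Fin.cons_zero]
      rw [mul_right_comm]
      rfl
    have := Fintype.linearIndependent_iff.mp hu _ hzero 0
    simp only [Fin.val_zero, pow_zero, one_mul, Fin.succAbove_zero] at this
    exact hI this

theorem plucker_ne_zero [Field K] {j : ℕ} {u : Fin j → ι → K} (hu : LinearIndependent K u) :
    plucker u ≠ 0 := by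
  obtain ⟨I, hI⟩ := exists_plucker_ne_zero hu
  exact fun h => hI (congrFun h I)

/-- A linearly independent finite family of functions bounds the coefficients of its linear
combinations, by their values at suitable finitely many points. -/
theorem exists_pos_forall_exists_le_norm_sum [NormedField K] {m : ℕ} {u : Fin m → ι → K}
    (hu : LinearIndependent K u) :
    ∃ c : ℝ, 0 < c ∧ ∀ a : Fin m → K, (∃ i, 1 ≤ ‖a i‖) → ∃ z, c ≤ ‖∑ i, a i * u i z‖ := by
  obtain ⟨I, hI⟩ := exists_plucker_ne_zero hu
  -- `A` evaluates the functions at points where it is invertible, so `a = A⁻¹ (A a)`; values below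
  -- `1 / (N + 1)` would force every `‖a i‖ < 1`.
  let A : Matrix (Fin m) (Fin m) K := Matrix.of fun a b => u b (I a)
  have hA : IsUnit A.det := isUnit_iff_ne_zero.mpr hI
  let N : ℝ := ∑ p, ∑ q, ‖A⁻¹ p q‖
  have hN : 0 ≤ N := by positivity
  refine ⟨1 / (N + 1), by positivity, fun a ⟨i, hi⟩ => ?_⟩
  by_contra! hlt
  have hmul : A⁻¹.mulVec (A.mulVec a) = a := by
    rw [Matrix.mulVec_mulVec, Matrix.nonsing_inv_mul _ hA, Matrix.one_mulVec]
  have hent : ∀ q, ‖A.mulVec a q‖ ≤ 1 / (N + 1) := by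
    intro q
    have := (hlt (I q)).le
    simpa [Matrix.mulVec, dotProduct, A, mul_comm] using this
  have : ‖a i‖ ≤ N * (1 / (N + 1)) := by
    conv_lhs => rw [← hmul]
    calc ‖A⁻¹.mulVec (A.mulVec a) i‖ ≤ ∑ q, ‖A⁻¹ i q‖ * ‖A.mulVec a q‖ := by
          refine (norm_sum_le Finset.univ (fun q => A⁻¹ i q * A.mulVec a q)).trans_eq ?_
          simp only [norm_mul]
      _ ≤ ∑ q, ‖A⁻¹ i q‖ * (1 / (N + 1)) := by
          gcongr with q
          exact hent q
      _ = (∑ q, ‖A⁻¹ i q‖) * (1 / (N + 1)) := by rw [Finset.sum_mul]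
      _ ≤ N * (1 / (N + 1)) := by
          gcongr
          exact Finset.single_le_sum (f := fun p => ∑ q, ‖A⁻¹ p q‖)
            (fun p _ => by positivity) (Finset.mem_univ i)
  have h1 : N * (1 / (N + 1)) < 1 := by
    rw [mul_one_div, div_lt_one (by positivity)]
    linarith
  linarith

end Plucker

/-! ### Rational subspaces, their covolumes, and short vectors. -/

section RationalSubspaces

variable {Fq ι : Type*} [Field Fq]

/-- A polynomial vector, seen as a vector over the field of Laurent series. -/
def polyVec (v : ι → Polynomial Fq) : ι → LaurentInf Fq := fun i => LaurentInf.ofPoly (v i)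

theorem polyVec_ne_zero {v : ι → Polynomial Fq} (hv : v ≠ 0) : polyVec v ≠ 0 := by
  obtain ⟨i, hi⟩ := Function.ne_iff.mp hv
  exact fun h => hi (LaurentInf.ofPoly_injective (by simpa [polyVec] using congrFun h i))

theorem plucker_polyVec {j : ℕ} (V : Fin j → ι → Polynomial Fq) (I : Fin j → ι) :
    plucker (fun b => polyVec (V b)) I = LaurentInf.ofPoly (plucker V I) :=
  plucker_map LaurentInf.ofPoly V I

theorem plucker_polyVec_eq_zero_or {j : ℕ} (V : Fin j → ι → Polynomial Fq) (I : Fin j → ι) :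
    plucker (fun b => polyVec (V b)) I = 0 ∨ 1 ≤ ‖plucker (fun b => polyVec (V b)) I‖ := by
  rw [plucker_polyVec]
  by_cases h : plucker V I = 0
  · left; rw [h, map_zero]
  · right; exact LaurentInf.one_le_norm_ofPoly h

/-- A tuple of polynomial vectors that is a basis of the subspace `W`. -/
def IsPolyBasis {j : ℕ} (V : Fin j → ι → Polynomial Fq)
    (W : Submodule (LaurentInf Fq) (ι → LaurentInf Fq)) : Prop :=
  LinearIndependent (LaurentInf Fq) (fun b => polyVec (V b)) ∧
    Submodule.span (LaurentInf Fq) (Set.range fun b => polyVec (V b)) = W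

theorem IsPolyBasis.finrank_eq {j : ℕ} {V : Fin j → ι → Polynomial Fq}
    {W : Submodule (LaurentInf Fq) (ι → LaurentInf Fq)} (h : IsPolyBasis V W) :
    Module.finrank (LaurentInf Fq) W = j := by
  rw [← h.2, finrank_span_eq_card h.1, Fintype.card_fin]

theorem isPolyBasis_bot :
    IsPolyBasis (Fin.elim0 : Fin 0 → ι → Polynomial Fq) ⊥ := by
  refine ⟨linearIndependent_empty_type, ?_⟩
  rw [Set.range_eq_empty, Submodule.span_empty]

theorem IsPolyBasis.cons {j : ℕ} {V : Fin j → ι → Polynomial Fq}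
    {W : Submodule (LaurentInf Fq) (ι → LaurentInf Fq)} (h : IsPolyBasis V W)
    {v : ι → Polynomial Fq} (hv : polyVec v ∉ W) :
    IsPolyBasis (Fin.cons v V : Fin (j + 1) → ι → Polynomial Fq)
      (W ⊔ Submodule.span (LaurentInf Fq) {polyVec v}) := by
  have heq : (fun b => polyVec ((Fin.cons v V : Fin (j + 1) → ι → Polynomial Fq) b)) =
      Fin.cons (polyVec v) (fun b => polyVec (V b)) := by
    funext b
    refine Fin.cases ?_ (fun i => ?_) b <;> simp
  rw [IsPolyBasis, heq]
  refine ⟨linearIndependent_finCons.mpr ⟨h.1, by rwa [h.2]⟩, ?_⟩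
  rw [Fin.range_cons, Set.insert_eq, Submodule.span_union, h.2, sup_comm]

variable [Fintype ι]

theorem exists_norm_plucker_eq_exp {j : ℕ} {V : Fin j → ι → Polynomial Fq}
    (h : LinearIndependent (LaurentInf Fq) (fun b => polyVec (V b))) :
    ∃ m : ℕ, ‖plucker (fun b => polyVec (V b))‖ = Real.exp m := by
  have : Nonempty (Fin j → ι) := ⟨(exists_plucker_ne_zero h).choose⟩
  obtain ⟨I, -, hI⟩ := Finset.exists_max_image Finset.univ
    (fun I => ‖plucker (fun b => polyVec (V b)) I‖) Finset.univ_nonempty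
  have heq : ‖plucker (fun b => polyVec (V b))‖ = ‖plucker (fun b => polyVec (V b)) I‖ :=
    le_antisymm ((pi_norm_le_iff_of_nonneg (norm_nonneg _)).mpr fun J => hI J (Finset.mem_univ _))
      (norm_le_pi_norm _ I)
  have hne : plucker V I ≠ 0 := by
    intro h0
    rw [plucker_polyVec, h0, map_zero, norm_zero, norm_eq_zero] at heq
    exact plucker_ne_zero h heq
  exact ⟨_, by rw [heq, plucker_polyVec, LaurentInf.norm_ofPoly hne]⟩

/-- Among the polynomial bases of a subspace there is one whose image under every linear map has
Plücker coordinates of least norm. -/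
theorem exists_minimal_isPolyBasis {W : Submodule (LaurentInf Fq) (ι → LaurentInf Fq)}
    (hW : ∃ (j : ℕ) (V : Fin j → ι → Polynomial Fq), IsPolyBasis V W) :
    ∃ (j : ℕ) (V : Fin j → ι → Polynomial Fq), IsPolyBasis V W ∧
      ∀ (j' : ℕ) (V' : Fin j' → ι → Polynomial Fq), IsPolyBasis V' W →
        ∀ g : Matrix ι ι (LaurentInf Fq),
          ‖plucker fun b => g.mulVec (polyVec (V b))‖ ≤
            ‖plucker fun b => g.mulVec (polyVec (V' b))‖ := by
  classical
  -- The norms are `exp m` with `m` natural, so a minimum exists. A change of basis scales all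
  -- Plücker coordinates by one determinant, before and after applying `g`, so one basis is minimal
  -- for every `g`.
  have hex : ∃ m : ℕ, ∃ (j : ℕ) (V : Fin j → ι → Polynomial Fq), IsPolyBasis V W ∧
      ‖plucker (fun b => polyVec (V b))‖ = Real.exp m := by
    obtain ⟨j, V, hV⟩ := hW
    obtain ⟨m, hm⟩ := exists_norm_plucker_eq_exp hV.1
    exact ⟨m, j, V, hV, hm⟩
  obtain ⟨j, V, hV, hm⟩ := Nat.find_spec hex
  refine ⟨j, V, hV, fun j' V' hV' g => ?_⟩
  obtain rfl : j = j' := hV.finrank_eq.symm.trans hV'.finrank_eq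
  obtain ⟨m', hm'⟩ := exists_norm_plucker_eq_exp hV'.1
  have hle : Nat.find hex ≤ m' := Nat.find_min' hex ⟨j, V', hV', hm'⟩
  have hmem : ∀ b, ∃ a : Fin j → LaurentInf Fq, ∑ c, a c • polyVec (V c) = polyVec (V' b) := by
    intro b
    rw [← Submodule.mem_span_range_iff_exists_fun, hV.2, ← hV'.2]
    exact Submodule.subset_span ⟨b, rfl⟩
  choose a ha using hmem
  let A : Matrix (Fin j) (Fin j) (LaurentInf Fq) := Matrix.of fun c b => a b c
  have h₁ := plucker_linearCombination (fun b => polyVec (V b)) (fun b => polyVec (V' b)) A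
    fun b => (ha b).symm
  have h₂ := plucker_linearCombination (fun b => g.mulVec (polyVec (V b)))
    (fun b => g.mulVec (polyVec (V' b))) A fun b => by
      rw [← ha b, ← Matrix.mulVecLin_apply, map_sum]
      simp [A]
  have hdet : 1 ≤ ‖A.det‖ := by
    rw [h₁, norm_smul, hm] at hm'
    have : Real.exp (Nat.find hex : ℕ) ≤ Real.exp (m' : ℕ) :=
      Real.exp_le_exp.mpr (by exact_mod_cast hle)
    rw [← hm'] at this
    exact (le_mul_iff_one_le_left (Real.exp_pos _)).mp this
  rw [h₂, norm_smul]
  exact le_mul_of_one_le_left (norm_nonneg _) hdet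

variable (Fq ι) in
/-- The poset of nonzero subspaces spanned by polynomial vectors. -/
abbrev RationalSubspace : Type _ :=
  {W : Submodule (LaurentInf Fq) (ι → LaurentInf Fq) //
    W ≠ ⊥ ∧ ∃ (j : ℕ) (V : Fin j → ι → Polynomial Fq), IsPolyBasis V W}

namespace RationalSubspace

/-- The dimension of a rational subspace. -/
def dim (W : RationalSubspace Fq ι) : ℕ := Module.finrank (LaurentInf Fq) W.1

theorem dim_strictMono : StrictMono (dim (Fq := Fq) (ι := ι)) := fun _ _ h =>
  Submodule.finrank_lt_finrank_of_lt h

theorem dim_pos (W : RationalSubspace Fq ι) : 0 < W.dim :=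
  Module.finrank_pos_iff.mpr (Submodule.nontrivial_iff_ne_bot.mpr W.2.1)

theorem dim_le (W : RationalSubspace Fq ι) : W.dim ≤ Fintype.card ι :=
  (Submodule.finrank_le W.1).trans_eq (Module.finrank_fintype_fun_eq_card _)

/-- A polynomial basis with Plücker coordinates of least norm. -/
def basis (W : RationalSubspace Fq ι) :
    Fin (exists_minimal_isPolyBasis W.2.2).choose → ι → Polynomial Fq :=
  (exists_minimal_isPolyBasis W.2.2).choose_spec.choose

theorem isPolyBasis_basis (W : RationalSubspace Fq ι) : IsPolyBasis W.basis W.1 :=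
  (exists_minimal_isPolyBasis W.2.2).choose_spec.choose_spec.1

/-- The covolume of a rational subspace after applying the linear map `g`. -/
def covol (W : RationalSubspace Fq ι) (g : Matrix ι ι (LaurentInf Fq)) : ℝ :=
  ‖plucker fun b => g.mulVec (polyVec (W.basis b))‖

theorem covol_le (W : RationalSubspace Fq ι) {j : ℕ} {V : Fin j → ι → Polynomial Fq}
    (hV : IsPolyBasis V W.1) (g : Matrix ι ι (LaurentInf Fq)) :
    W.covol g ≤ ‖plucker fun b => g.mulVec (polyVec (V b))‖ :=
  (exists_minimal_isPolyBasis W.2.2).choose_spec.choose_spec.2 _ V hV g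

/-- Adjoining `v` multiplies the Plücker norm by at most `‖g v‖`. Here `W` is a plain submodule so
that `⊥` is allowed. -/
theorem le_norm_mulVec_of_isPolyBasis {j : ℕ} {V : Fin j → ι → Polynomial Fq}
    {W : Submodule (LaurentInf Fq) (ι → LaurentInf Fq)} (hV : IsPolyBasis V W)
    (W' : RationalSubspace Fq ι) {v : ι → Polynomial Fq} (hv : polyVec v ∉ W)
    (hW' : W'.1 = W ⊔ Submodule.span (LaurentInf Fq) {polyVec v})
    (g : Matrix ι ι (LaurentInf Fq))
    (hle : ‖plucker fun b => g.mulVec (polyVec (V b))‖ ≤ 1) :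
    W'.covol g ≤ ‖g.mulVec (polyVec v)‖ := by
  have hb := hV.cons hv
  rw [← hW'] at hb
  refine (W'.covol_le hb g).trans ?_
  have heq : (fun b => g.mulVec (polyVec ((Fin.cons v V : Fin (j + 1) → ι → Polynomial Fq) b))) =
      Fin.cons (g.mulVec (polyVec v)) (fun b => g.mulVec (polyVec (V b))) := by
    funext b
    refine Fin.cases ?_ (fun i => ?_) b <;> simp
  rw [heq]
  exact (norm_plucker_cons_le _ _).trans (mul_le_of_le_one_right (norm_nonneg _) hle)

/-- At a marked point there are no nonzero lattice vectors of norm less than `ε`. -/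
theorem le_norm_mulVec_of_isMarked {X : Type*} {g : X → Matrix ι ι (LaurentInf Fq)} {ε : ℝ}
    (hε : ε ≤ 1) {x : X}
    (h : IsMarked (fun (W : RationalSubspace Fq ι) y => W.covol (g y)) ε Set.univ x)
    {v : ι → Polynomial Fq} (hv : v ≠ 0) : ε ≤ ‖(g x).mulVec (polyVec v)‖ := by
  obtain ⟨c, -, hc, hc₁, hc₂⟩ := h
  -- `W` is the largest member of the chain missing `v`, or `⊥` if there is none; the empty minor is
  -- 1, so `⊥` meets the bound.
  obtain ⟨W, j, V, hV, hvW, hle, hmax⟩ :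
      ∃ (W : Submodule (LaurentInf Fq) (ι → LaurentInf Fq)) (j : ℕ)
        (V : Fin j → ι → Polynomial Fq), IsPolyBasis V W ∧ polyVec v ∉ W ∧
        ‖plucker fun b => (g x).mulVec (polyVec (V b))‖ ≤ 1 ∧
        ∀ W' ∈ c, (polyVec v ∉ W'.1 → W'.1 ≤ W) ∧ (polyVec v ∈ W'.1 → W ≤ W'.1) := by
    by_cases hex : ∃ W ∈ c, polyVec v ∉ W.1
    · obtain ⟨W, ⟨hWc, hvW⟩, hmax⟩ : ∃ W ∈ {W ∈ c | polyVec v ∉ W.1},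
          ∀ W' ∈ {W ∈ c | polyVec v ∉ W.1}, W'.dim ≤ W.dim := by
        have hfin : (dim '' {W ∈ c | polyVec v ∉ W.1}).Finite :=
          (Set.finite_Iic (Fintype.card ι)).subset (by rintro _ ⟨W, -, rfl⟩; exact W.dim_le)
        obtain ⟨W, hW, hWmax⟩ := Set.exists_max_image _ id hfin (Set.Nonempty.image _ hex)
        obtain ⟨W, hW', rfl⟩ := hW
        exact ⟨W, hW', fun W' h => hWmax _ ⟨W', h, rfl⟩⟩
      refine ⟨W.1, _, W.basis, W.isPolyBasis_basis, hvW, (hc₁ W hWc).2, fun W' hW' => ⟨?_, ?_⟩⟩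
      · intro hvW'
        rcases hc.total hW' hWc with h | h
        · exact h
        · rcases h.lt_or_eq with h | h
          · exact absurd (hmax W' ⟨hW', hvW'⟩) (not_le.mpr (dim_strictMono h))
          · exact h.ge
      · intro hvW'
        rcases hc.total hW' hWc with h | h
        · exact absurd (h hvW') hvW
        · exact h
    · push Not at hex
      refine ⟨⊥, 0, Fin.elim0, isPolyBasis_bot, polyVec_ne_zero hv, ?_, fun W' hW' =>
        ⟨fun h => absurd (hex W' hW') h, fun _ => bot_le⟩⟩
      refine (pi_norm_le_iff_of_nonneg zero_le_one).mpr fun I => ?_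
      simp [plucker]
  let W' : RationalSubspace Fq ι := ⟨W ⊔ Submodule.span (LaurentInf Fq) {polyVec v}, by
    intro h
    have : polyVec v ∈ W ⊔ Submodule.span (LaurentInf Fq) {polyVec v} :=
      Submodule.mem_sup_right (Submodule.mem_span_singleton_self _)
    rw [h] at this
    exact polyVec_ne_zero hv this, _, _, hV.cons hvW⟩
  -- `W' = W + F v` is comparable to the whole chain: members containing `v` contain `W'`, the
  -- others lie in `W`.
  have hε' : ε ≤ W'.covol (g x) := by
    by_cases hW' : W' ∈ c
    · exact (hc₁ W' hW').1
    · refine hε.trans (hc₂ W' (Set.mem_univ _) hW' fun W'' hW'' => ?_)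
      by_cases hvW'' : polyVec v ∈ W''.1
      · left
        exact sup_le ((hmax W'' hW'').2 hvW'')
          ((Submodule.span_singleton_le_iff_mem _ _).mpr hvW'')
      · right
        exact ((hmax W'' hW'').1 hvW'').trans le_sup_left
  exact hε'.trans (le_norm_mulVec_of_isPolyBasis hV W' hvW rfl (g x) hle)

end RationalSubspace

end RationalSubspaces

/-! ### Plücker coordinates under the unipotent map. -/

section Shear

variable {K : Type*} [Field K] {n : ℕ}

/-- The unipotent map `u ↦ (u₀ + ∑ yᵢ uᵢ, u₁, …, u_n)`. -/
def shear (y : Fin n → K) (u : Fin 1 ⊕ Fin n → K) : Fin 1 ⊕ Fin n → K :=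
  Sum.elim (fun _ => u (Sum.inl 0) + ∑ i, y i * u (Sum.inr i)) fun i => u (Sum.inr i)

theorem plucker_shear_of_ne {j : ℕ} (y : Fin n → K) (u : Fin j → Fin 1 ⊕ Fin n → K)
    {I : Fin j → Fin 1 ⊕ Fin n} (h : ∀ b, I b ≠ Sum.inl 0) :
    plucker (fun b => shear y (u b)) I = plucker u I := by
  unfold plucker
  congr 1
  ext a b
  rcases hI : I a with i | i
  · exact absurd (hI.trans (by rw [Subsingleton.elim i 0])) (h a)
  · simp [shear, hI]

theorem plucker_shear_of_unique {j : ℕ} (y : Fin n → K) (u : Fin j → Fin 1 ⊕ Fin n → K)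
    {I : Fin j → Fin 1 ⊕ Fin n} {a : Fin j} (ha : I a = Sum.inl 0)
    (h : ∀ b, b ≠ a → I b ≠ Sum.inl 0) :
    plucker (fun b => shear y (u b)) I =
      plucker u I + ∑ i, y i * plucker u (Function.update I a (Sum.inr i)) := by
  -- The shear alters only row `a`, and the determinant is linear in that row.
  let L : (Fin j → K) →ₗ[K] K :=
    (Matrix.detRowAlternating (n := Fin j) (R := K)).toMultilinearMap.toLinearMap
      (fun a b => u b (I a)) a
  have hL : ∀ i, L (fun b => u b i) = plucker u (Function.update I a i) := by
    intro i
    change Matrix.det _ = Matrix.det _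
    congr 1
    ext p q
    by_cases hp : p = a
    · subst hp; simp
    · simp [hp]
  have hLs : plucker (fun b => shear y (u b)) I =
      L ((fun b => u b (Sum.inl 0)) + ∑ i, y i • fun b => u b (Sum.inr i)) := by
    change Matrix.det _ = Matrix.det _
    congr 1
    ext p q
    by_cases hp : p = a
    · subst hp
      simp [ha, shear]
    · rcases hI : I p with i | i
      · exact absurd (hI.trans (by rw [Subsingleton.elim i 0])) (h p hp)
      · simp [shear, hI, hp]
  rw [hLs, map_add, map_sum, hL, ← ha, Function.update_eq_self]
  congr 1
  refine Finset.sum_congr rfl fun i _ => ?_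
  rw [map_smul, hL, smul_eq_mul]

/-- The Plücker coordinates of a sheared tuple are linear combinations of `1, y₁, …, y_n`. -/
theorem exists_plucker_shear_eq {j : ℕ} (u : Fin j → Fin 1 ⊕ Fin n → K)
    (I : Fin j → Fin 1 ⊕ Fin n) :
    ∃ c : Fin (n + 1) → K, ∀ y : Fin n → K,
      plucker (fun b => shear y (u b)) I = ∑ i, c i * (Fin.cons 1 y : Fin (n + 1) → K) i := by
  by_cases h0 : ∀ b, I b ≠ Sum.inl 0
  · refine ⟨Fin.cons (plucker u I) 0, fun y => ?_⟩
    rw [plucker_shear_of_ne y u h0, Fin.sum_univ_succ]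
    simp
  push Not at h0
  obtain ⟨a, ha⟩ := h0
  by_cases h1 : ∀ b, b ≠ a → I b ≠ Sum.inl 0
  · refine ⟨Fin.cons (plucker u I) fun i => plucker u (Function.update I a (Sum.inr i)),
      fun y => ?_⟩
    rw [plucker_shear_of_unique y u ha h1, Fin.sum_univ_succ]
    simp [mul_comm]
  · push Not at h1
    obtain ⟨b, hb, hb0⟩ := h1
    refine ⟨0, fun y => ?_⟩
    rw [plucker_eq_zero_of_eq _ hb (hb0.trans ha.symm)]
    simp

end Shear

/-! ### Expansion of Plücker coordinates by the flow. -/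

section FlowMatrix

open LaurentInf

variable {Fq : Type*} [Field Fq] {n : ℕ}

/-- The matrix of `g_t τ(y)`. -/
def flowMatrix (t : aPlus 1 n) (y : Fin n → LaurentInf Fq) :
    Matrix (Fin 1 ⊕ Fin n) (Fin 1 ⊕ Fin n) (LaurentInf Fq) :=
  (gFlow Fq t * tau (Matrix.replicateRow (Fin 1) y) : GroupG Fq 1 n)

/-- The diagonal entries of `g_t`. -/
def flowWeight (Fq : Type*) [Field Fq] (t : aPlus 1 n) : Fin 1 ⊕ Fin n → LaurentInf Fq :=
  Sum.elim (fun i => T Fq ^ t.1 (Sum.inl i)) (fun j => (T Fq ^ t.1 (Sum.inr j))⁻¹)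

/-- The degrees of the diagonal entries of `g_t`. -/
def flowExponent (t : aPlus 1 n) : Fin 1 ⊕ Fin n → ℝ :=
  Sum.elim (fun i => (t.1 (Sum.inl i) : ℝ)) (fun j => -(t.1 (Sum.inr j) : ℝ))

theorem norm_flowWeight (t : aPlus 1 n) (i : Fin 1 ⊕ Fin n) :
    ‖flowWeight Fq t i‖ = Real.exp (flowExponent t i) := by
  rcases i with i | i
  · simp [flowWeight, flowExponent, norm_T, ← Real.exp_nat_mul]
  · simp [flowWeight, flowExponent, norm_T, ← Real.exp_nat_mul, Real.exp_neg]

theorem flowMatrix_mulVec (t : aPlus 1 n) (y : Fin n → LaurentInf Fq)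
    (u : Fin 1 ⊕ Fin n → LaurentInf Fq) (i : Fin 1 ⊕ Fin n) :
    (flowMatrix t y).mulVec u i = flowWeight Fq t i * shear y u i := by
  have h : (flowMatrix t y) = Matrix.diagonal (flowWeight Fq t) *
      Matrix.fromBlocks 1 (Matrix.replicateRow (Fin 1) y) 0 1 := rfl
  rw [h, ← Matrix.mulVec_mulVec, Matrix.mulVec_diagonal]
  congr 1
  rcases i with i | i
  · rw [Subsingleton.elim i 0]
    simp [shear, Matrix.mulVec, dotProduct]
  · simp [Matrix.fromBlocks_mulVec, shear]

theorem plucker_flowMatrix {j : ℕ} (t : aPlus 1 n) (y : Fin n → LaurentInf Fq)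
    (u : Fin j → Fin 1 ⊕ Fin n → LaurentInf Fq) (I : Fin j → Fin 1 ⊕ Fin n) :
    plucker (fun b => (flowMatrix t y).mulVec (u b)) I =
      (∏ a, flowWeight Fq t (I a)) * plucker (fun b => shear y (u b)) I := by
  rw [plucker, plucker, ← Matrix.det_mul_column]
  congr 1
  ext a b
  simp [flowMatrix_mulVec]

theorem exists_plucker_flowMatrix_eq {j : ℕ} (t : aPlus 1 n)
    (u : Fin j → Fin 1 ⊕ Fin n → LaurentInf Fq) (I : Fin j → Fin 1 ⊕ Fin n) :
    ∃ c : Fin (n + 1) → LaurentInf Fq, ∀ y : Fin n → LaurentInf Fq,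
      plucker (fun b => (flowMatrix t y).mulVec (u b)) I =
        ∑ i, c i * (Fin.cons 1 y : Fin (n + 1) → LaurentInf Fq) i := by
  obtain ⟨c, hc⟩ := exists_plucker_shear_eq u I
  refine ⟨fun i => (∏ a, flowWeight Fq t (I a)) * c i, fun y => ?_⟩
  rw [plucker_flowMatrix, hc, Finset.mul_sum]
  simp only [mul_assoc]

/-- The exponents of `g_t` sum to 0, so a weight can be read off from the omitted indices. If the
expanding index is used, every omitted one contributes a factor at least 1. -/
theorem norm_prod_flowWeight {j : ℕ} (t : aPlus 1 n) {I : Fin j → Fin 1 ⊕ Fin n}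
    (hI : Function.Injective I) : ‖∏ a, flowWeight Fq t (I a)‖ =
      Real.exp (∑ i ∈ (Finset.univ.image I)ᶜ, -flowExponent t i) := by
  classical
  rw [norm_prod]
  simp only [norm_flowWeight]
  rw [← Real.exp_sum]
  congr 1
  have h₁ : ∑ a, flowExponent t (I a) = ∑ i ∈ Finset.univ.image I, flowExponent t i :=
    (Finset.sum_image fun _ _ _ _ h => hI h).symm
  have h₂ : ∑ i, flowExponent t i = 0 := by
    have := t.2
    simp only [aPlus, Set.mem_ofPred_eq] at this
    simp only [flowExponent, Fintype.sum_sum_type, Sum.elim_inl, Sum.elim_inr,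
      Finset.sum_neg_distrib]
    rw [← Nat.cast_sum, ← Nat.cast_sum, this, add_neg_cancel]
  rw [h₁, Finset.sum_neg_distrib]
  linarith [Finset.sum_add_sum_compl (Finset.univ.image I) (flowExponent t)]

theorem neg_flowExponent_nonneg {j : ℕ} (t : aPlus 1 n) {I : Fin j → Fin 1 ⊕ Fin n} {a : Fin j}
    (ha : I a = Sum.inl 0) : ∀ i ∈ (Finset.univ.image I)ᶜ, 0 ≤ -flowExponent t i := by
  intro i hi
  rcases i with i | i
  · rw [Finset.mem_compl] at hi
    exact absurd (Finset.mem_image.mpr ⟨a, Finset.mem_univ _, by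
      rw [ha, Subsingleton.elim i 0]⟩) hi
  · simp [flowExponent]

theorem one_le_norm_prod_flowWeight {j : ℕ} (t : aPlus 1 n) {I : Fin j → Fin 1 ⊕ Fin n}
    (hI : Function.Injective I) {a : Fin j} (ha : I a = Sum.inl 0) :
    1 ≤ ‖∏ a, flowWeight Fq t (I a)‖ := by
  rw [norm_prod_flowWeight t hI]
  exact Real.one_le_exp (Finset.sum_nonneg (neg_flowExponent_nonneg t ha))

theorem exp_le_norm_prod_flowWeight {j : ℕ} (t : aPlus 1 n) {I : Fin j → Fin 1 ⊕ Fin n}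
    (hI : Function.Injective I) {a : Fin j} (ha : I a = Sum.inl 0) {i : Fin n}
    (hi : ∀ b, I b ≠ Sum.inr i) :
    Real.exp (t.1 (Sum.inr i)) ≤ ‖∏ a, flowWeight Fq t (I a)‖ := by
  rw [norm_prod_flowWeight t hI]
  refine Real.exp_le_exp.mpr ?_
  have h := Finset.single_le_sum (neg_flowExponent_nonneg t ha)
    (a := Sum.inr i) (by simpa using hi)
  simpa [flowExponent] using h

/-- If the largest contraction rate is large, then no tuple of lattice vectors is contracted at
every point of `Z`. -/
theorem exists_one_le_norm_plucker_flowMatrix {X : Type*} {Z : Set X} (hZ : Z.Nonempty)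
    (f : X → Fin n → LaurentInf Fq) {c : ℝ}
    (hc : ∀ a : Fin (n + 1) → LaurentInf Fq, (∃ i, 1 ≤ ‖a i‖) →
      ∃ z ∈ Z, c ≤ ‖∑ i, a i * (Fin.cons 1 (f z) : Fin (n + 1) → LaurentInf Fq) i‖)
    (t : aPlus 1 n) (k : Fin n) (hk : 1 ≤ Real.exp (t.1 (Sum.inr k)) * c)
    {j : ℕ} (hj : 0 < j) (u : Fin j → Fin 1 ⊕ Fin n → LaurentInf Fq) (hne : plucker u ≠ 0)
    (hdisc : ∀ I, plucker u I = 0 ∨ 1 ≤ ‖plucker u I‖) :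
    ∃ z ∈ Z, 1 ≤ ‖plucker fun b => (flowMatrix t (f z)).mulVec (u b)‖ := by
  have hinj : ∀ I, plucker u I ≠ 0 → Function.Injective I := by
    intro I hI a b hab
    by_contra h
    exact hI (plucker_eq_zero_of_eq u h hab)
  by_cases hJ : ∃ J : Fin j → Fin 1 ⊕ Fin n, (∀ b, J b ≠ Sum.inl 0) ∧ plucker u J ≠ 0
  · obtain ⟨J, hJ0, hJne⟩ := hJ
    have hJinj := hinj J hJne
    -- Replacing `J a` by the expanding index must leave `k` omitted, so that the weight is at least
    -- `exp t_k`; if `k` occurs in `J`, it is the entry replaced.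
    obtain ⟨a, hak⟩ : ∃ a, ∀ b, b ≠ a → J b ≠ Sum.inr k := by
      by_cases h : ∃ a, J a = Sum.inr k
      · obtain ⟨a, ha⟩ := h
        exact ⟨a, fun b hb hbk => hb (hJinj (hbk.trans ha.symm))⟩
      · push Not at h
        exact ⟨⟨0, hj⟩, fun b _ => h b⟩
    obtain ⟨i, hi⟩ : ∃ i, J a = Sum.inr i := by
      rcases h : J a with i | i
      · exact absurd (h.trans (by rw [Subsingleton.elim i 0])) (hJ0 a)
      · exact ⟨i, rfl⟩
    let I := Function.update J a (Sum.inl 0)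
    have hIa : I a = Sum.inl 0 := Function.update_self _ _ _
    have hIb : ∀ b, b ≠ a → I b = J b := fun b hb => Function.update_of_ne hb _ _
    have hIinj : Function.Injective I := by
      intro p q hpq
      by_cases hp : p = a <;> by_cases hq : q = a
      · rw [hp, hq]
      · rw [hp, hIa, hIb q hq] at hpq
        exact absurd hpq.symm (hJ0 q)
      · rw [hq, hIa, hIb p hp] at hpq
        exact absurd hpq (hJ0 p)
      · rw [hIb p hp, hIb q hq] at hpq
        exact hJinj hpq
    have hIk : ∀ b, I b ≠ Sum.inr k := by
      intro b
      by_cases hb : b = a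
      · rw [hb, hIa]; exact Sum.inl_ne_inr
      · rw [hIb b hb]; exact hak b hb
    have hIJ : Function.update I a (Sum.inr i) = J := by
      simp only [I, Function.update_idem, ← hi, Function.update_eq_self]
    -- The minor at `J` reappears as the coefficient of `f_i` in coordinate `I`, and its norm is at
    -- least 1 by discreteness.
    obtain ⟨z, hz, hcz⟩ := hc
      (Fin.cons (plucker u I) fun i => plucker u (Function.update I a (Sum.inr i)))
      ⟨i.succ, by rw [Fin.cons_succ, hIJ]; exact (hdisc J).resolve_left hJne⟩
    refine ⟨z, hz, le_trans ?_ (norm_le_pi_norm _ I)⟩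
    rw [plucker_flowMatrix, norm_mul, plucker_shear_of_unique (f z) u hIa fun b hb => by
      rw [hIb b hb]; exact hJ0 b]
    rw [Fin.sum_univ_succ] at hcz
    simp only [Fin.cons_zero, Fin.cons_succ, mul_one] at hcz
    simp only [mul_comm (f z _)]
    have hexp := exp_le_norm_prod_flowWeight (Fq := Fq) t hIinj hIa hIk
    by_cases hc0 : 0 ≤ c
    · exact hk.trans (mul_le_mul hexp hcz hc0 (norm_nonneg _))
    · have := mul_neg_of_pos_of_neg (Real.exp_pos (t.1 (Sum.inr k))) (not_le.mp hc0)
      linarith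
  -- All nonzero minors use the expanding index, so coordinate `I` of the sheared tuple is constant
  -- and its weight is at least 1.
  · push Not at hJ
    obtain ⟨I, hI⟩ := Function.ne_iff.mp hne
    rw [Pi.zero_apply] at hI
    have hIinj := hinj I hI
    obtain ⟨a, ha⟩ : ∃ a, I a = Sum.inl 0 := by
      by_contra! h
      exact hI (hJ I h)
    have hIb : ∀ b, b ≠ a → I b ≠ Sum.inl 0 := fun b hb h => hb (hIinj (h.trans ha.symm))
    obtain ⟨z, hz⟩ := hZ
    refine ⟨z, hz, le_trans ?_ (norm_le_pi_norm _ I)⟩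
    rw [plucker_flowMatrix, norm_mul, plucker_shear_of_unique (f z) u ha hIb]
    have hsum : ∑ i, f z i * plucker u (Function.update I a (Sum.inr i)) = 0 := by
      refine Finset.sum_eq_zero fun i _ => ?_
      rw [hJ, mul_zero]
      intro b
      by_cases hb : b = a
      · rw [hb, Function.update_self]; exact Sum.inr_ne_inl
      · rw [Function.update_of_ne hb]; exact hIb b hb
    rw [hsum, add_zero]
    exact one_le_mul_of_one_le_of_one_le (one_le_norm_prod_flowWeight t hIinj ha)
      ((hdisc I).resolve_left hI)

/-- The only entry that can exceed the largest contraction exponent is `t_0`, a sum of `n` of these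
exponents. -/
theorem exists_tupleNorm_le (hn : 1 ≤ n) (t : aPlus 1 n) :
    ∃ k : Fin n, tupleNorm t.1 ≤ n * t.1 (Sum.inr k) := by
  have : Nonempty (Fin n) := ⟨⟨0, hn⟩⟩
  obtain ⟨k, -, hk⟩ := Finset.exists_max_image Finset.univ (fun i => t.1 (Sum.inr i))
    Finset.univ_nonempty
  refine ⟨k, Finset.sup_le fun i _ => ?_⟩
  rcases i with i | i
  · have := t.2
    simp only [aPlus, Set.mem_ofPred_eq, Fin.sum_univ_one] at this
    rw [Subsingleton.elim i 0, this]
    refine (Finset.sum_le_card_nsmul _ _ _ hk).trans ?_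
    simp
  · exact (hk i (Finset.mem_univ _)).trans (Nat.le_mul_of_pos_left _ hn)

theorem flow_smul_tauBar_mem_setK (t : aPlus 1 n) (y : Fin n → LaurentInf Fq) {ε : ℝ}
    (h : ∀ v : Fin 1 ⊕ Fin n → Polynomial Fq, v ≠ 0 →
      ε ≤ ‖(flowMatrix t y).mulVec (polyVec v)‖) :
    gFlow Fq t • tauBar (Matrix.replicateRow (Fin 1) y) ∈ setK Fq ε :=
  ⟨gFlow Fq t * tau (Matrix.replicateRow (Fin 1) y), h, rfl⟩

end FlowMatrix

section GoodFunctions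

variable {X K : Type*} [PseudoMetricSpace X] [MeasurableSpace X] [NormedField K]

theorem IsGood.measure_lt_le {C α : ℝ} (hα : 0 < α) {U : Set X} {ν : Measure X} {φ : X → K}
    (h : IsGood C α U ν φ) {x : X} (hx : x ∈ ν.support) {r : ℝ} (hr : 0 < r) (hU : ball x r ⊆ U)
    {z : X} (hz : z ∈ ball x r ∩ ν.support) (h1 : 1 ≤ ‖φ z‖) {ε : ℝ} (hε : 0 < ε) :
    ν {y | y ∈ ball x r ∧ ‖φ y‖ < ε} ≤
      ENNReal.ofReal C * ENNReal.ofReal ε ^ α * ν (ball x r) := by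
  refine (h x hx r hr hU ε hε).trans ?_
  have hsup : 1 ≤ supNormOn ν (ball x r) φ := by
    refine le_trans ?_ (le_iSup₂ (f := fun x _ => ‖φ x‖ₑ) z hz)
    rwa [← ofReal_norm, ENNReal.one_le_ofReal]
  gcongr
  exact ENNReal.div_le_of_le_mul (le_mul_of_one_le_right' hsup)

theorem IsFederer.measure_le {D : ℝ} (hD : 0 < D) {U : Set X} {ν : Measure X}
    (h : IsFederer D U ν) {x : X} (hx : x ∈ ν.support) {r : ℝ} (hr : 0 < r)
    (hU : ball x (3 * r) ⊆ U) : ν (ball x (3 * r)) ≤ ENNReal.ofReal D * ν (ball x r) := by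
  have hpos : ν (ball x r) ≠ 0 :=
    ((Measure.mem_support_iff_forall x).mp hx _ (ball_mem_nhds x hr)).ne'
  by_cases htop : ν (ball x r) = ⊤
  · rw [htop, ENNReal.mul_top (by simpa using hD)]
    exact le_top
  · exact (ENNReal.div_le_iff hpos htop).mp (h x hx r hr hU)

end GoodFunctions

end

/-! ### Assembly of the proposition. -/

theorem proposition4p1 {Fq : Type*} [Field Fq] [Finite Fq]
    (d n : ℕ) (hd : 1 ≤ d) (hn : 1 ≤ n)
    (C α D : ℝ) (hC : 0 < C) (hα : 0 < α) (hD : 0 < D)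
    [MeasurableSpace (Fin d → LaurentInf Fq)] [BorelSpace (Fin d → LaurentInf Fq)]
    (ν : Measure (Fin d → LaurentInf Fq)) [ν.Regular]
    (x₀ : Fin d → LaurentInf Fq) (hx₀ : x₀ ∈ ν.support) (r : ℝ) (hr : 0 < r)
    (hFed : IsFederer D (ball x₀ (3 ^ (n + 1) * r)) ν)
    (f : (Fin d → LaurentInf Fq) → Fin n → LaurentInf Fq)
    (hf : ContinuousOn f (ball x₀ (3 ^ (n + 1) * r)))
    (hgood : ∀ c : Fin (n + 1) → LaurentInf Fq,
      IsGood C α (ball x₀ (3 ^ (n + 1) * r)) ν (fun x => ∑ i, c i * oneAnd f i x))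
    (hlin : LinearIndependent (LaurentInf Fq)
      (fun (i : Fin (n + 1)) (x : ↥(ball x₀ r ∩ ν.support)) => oneAnd f i x.1)) :
    ∃ s : ℝ, 0 < s ∧ ∀ t : aPlus 1 n, s ≤ (tupleNorm t.1 : ℝ) →
      ∀ ε : ℝ, 0 < ε → ε ≤ 1 / Real.exp 1 →
        ν {x | x ∈ ball x₀ r ∧
            gFlow Fq t • tauBar (Matrix.replicateRow (Fin 1) (f x)) ∉ setK Fq ε} ≤
          ENNReal.ofReal (((n : ℝ) + 1) * C * D ^ (2 * (n + 1)) * ε ^ α) * ν (ball x₀ r) := by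
  have hexp1 : 1 / Real.exp 1 ≤ 1 :=
    (div_le_one (Real.exp_pos 1)).mpr (Real.one_le_exp zero_le_one)
  set B := ball x₀ r with hB
  have hsub3 : ball x₀ (3 * r) ⊆ ball x₀ (3 ^ (n + 1) * r) := by
    refine ball_subset_ball (mul_le_mul_of_nonneg_right ?_ hr.le)
    exact le_self_pow₀ (by norm_num) (Nat.succ_ne_zero n)
  have hsub : B ⊆ ball x₀ (3 ^ (n + 1) * r) :=
    (ball_subset_ball (by linarith)).trans hsub3
  have hZ : (B ∩ ν.support).Nonempty := ⟨x₀, mem_ball_self hr, hx₀⟩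
  obtain ⟨c, hc, hlow⟩ := exists_pos_forall_exists_le_norm_sum hlin
  have hlow' : ∀ a : Fin (n + 1) → LaurentInf Fq, (∃ i, 1 ≤ ‖a i‖) → ∃ z ∈ B ∩ ν.support,
      c ≤ ‖∑ i, a i * (Fin.cons 1 (f z) : Fin (n + 1) → LaurentInf Fq) i‖ := by
    intro a ha
    obtain ⟨z, hz⟩ := hlow a ha
    exact ⟨z.1, z.2, hz⟩
  -- Some `t_k` is at least `‖t‖ / n`, hence at least `log (1 / c)`, which gives `1 ≤ exp t_k * c`.
  refine ⟨max 1 (n * Real.log (1 / c)), by positivity, fun t ht ε hε hε1 => ?_⟩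
  have hε1' : ε ≤ 1 := hε1.trans hexp1
  by_cases hfin : ν B = ⊤
  · rw [hfin, ENNReal.mul_top]
    · exact le_top
    · rw [Ne, ENNReal.ofReal_eq_zero, not_le]
      positivity
  obtain ⟨k, hk⟩ := exists_tupleNorm_le hn t
  have hn0 : (0 : ℝ) < n := by exact_mod_cast hn
  have hkc : 1 ≤ Real.exp (t.1 (Sum.inr k)) * c := by
    have h₁ : (n : ℝ) * Real.log (1 / c) ≤ n * t.1 (Sum.inr k) :=
      ((le_max_right _ _).trans ht).trans (by exact_mod_cast hk)
    have h₂ := (Real.log_le_iff_le_exp (by positivity)).mp (le_of_mul_le_mul_left h₁ hn0)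
    rwa [div_le_iff₀ hc] at h₂
  have hFed' : ∀ x ∈ ν.support, ∀ r' : ℝ, 0 < r' →
      ball x (3 * r') ⊆ ball x₀ (3 ^ (n + 1) * r) →
      ν (ball x (3 * r')) ≤ ENNReal.ofReal D * ν (ball x r') :=
    fun x hx r' hr' hU => hFed.measure_le hD hx hr' hU
  -- From `ν B ≤ ν (3B) ≤ D ν B` with `0 < ν B < ∞`.
  have hD1 : 1 ≤ ENNReal.ofReal D := by
    have hpos : ν B ≠ 0 :=
      ((Measure.mem_support_iff_forall x₀).mp hx₀ _ (ball_mem_nhds x₀ hr)).ne'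
    have h := (measure_mono (ball_subset_ball (by linarith : r ≤ 3 * r))).trans (hFed' x₀ hx₀ r hr hsub3)
    rw [← hB] at h
    exact (ENNReal.mul_le_mul_iff_left hpos hfin).mp (by rwa [one_mul])
  let ψ : RationalSubspace Fq (Fin 1 ⊕ Fin n) → (Fin d → LaurentInf Fq) → ℝ :=
    fun W x => W.covol (flowMatrix t (f x))
  have hcoord : ∀ (W : RationalSubspace Fq (Fin 1 ⊕ Fin n)) I,
      ∃ a : Fin (n + 1) → LaurentInf Fq,
      (fun x => plucker (fun b => (flowMatrix t (f x)).mulVec (polyVec (W.basis b))) I) =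
        fun x => ∑ i, a i * oneAnd f i x := by
    intro W I
    obtain ⟨a, ha⟩ := exists_plucker_flowMatrix_eq t (fun b => polyVec (W.basis b)) I
    exact ⟨a, funext fun x => ha (f x)⟩
  have hcont : ∀ W, ContinuousOn (ψ W) (ball x₀ (3 ^ (n + 1) * r)) := by
    intro W
    refine ContinuousOn.norm (continuousOn_pi.mpr fun I => ?_)
    obtain ⟨a, ha⟩ := hcoord W I
    rw [ha]
    refine continuousOn_finsetSum _ fun i _ => continuousOn_const.mul ?_
    refine Fin.cases ?_ (fun l => ?_) i
    · exact continuousOn_const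
    · exact continuousOn_pi.mp hf l
  have hgood' : ∀ W, ∀ x ∈ ν.support, ∀ r' : ℝ, 0 < r' →
      ball x r' ⊆ ball x₀ (3 ^ (n + 1) * r) →
      (∃ z ∈ ball x r' ∩ ν.support, 1 ≤ ψ W z) →
      ν {y | y ∈ ball x r' ∧ ψ W y < ε} ≤
        ENNReal.ofReal C * ENNReal.ofReal ε ^ α * ν (ball x r') := by
    rintro W x hx r' hr' hU ⟨z, hz, h1⟩
    -- One coordinate suffices: it reaches norm 1 at `z`, and it is below `ε` wherever `ψ W` is.
    obtain ⟨I, hI⟩ : ∃ I, 1 ≤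
        ‖plucker (fun b => (flowMatrix t (f z)).mulVec (polyVec (W.basis b))) I‖ := by
      by_contra! h
      exact absurd h1 (not_le.mpr ((pi_norm_lt_iff one_pos).mpr h))
    obtain ⟨a, ha⟩ := hcoord W I
    have hg := hgood a
    rw [← ha] at hg
    refine (measure_mono ?_).trans (hg.measure_lt_le hα hx hr' hU hz hI hε)
    exact fun y hy => ⟨hy.1, (norm_le_pi_norm _ I).trans_lt hy.2⟩
  have hbig : ∀ W ∈ (Set.univ : Set (RationalSubspace Fq (Fin 1 ⊕ Fin n))),
      ∃ z ∈ B ∩ ν.support, 1 ≤ ψ W z := by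
    intro W _
    refine exists_one_le_norm_plucker_flowMatrix hZ f hlow' t k hkc ?_ _
      (plucker_ne_zero W.isPolyBasis_basis.1) (plucker_polyVec_eq_zero_or W.basis)
    rw [← W.isPolyBasis_basis.finrank_eq]
    exact W.dim_pos
  have hmain := measure_not_isMarked_le ν RationalSubspace.dim_strictMono ψ hD1 ε hFed' hcont
    hgood' (n + 1) (Finset.Icc 1 (n + 1)) (by simp) Set.univ
    (fun W _ => Finset.mem_Icc.mpr ⟨W.dim_pos, W.dim_le.trans_eq (by simp [add_comm])⟩)
    x₀ r hr hsub hfin hbig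
  -- Points off the support are not controlled, but they form a null set by regularity.
  have hcover : {x | x ∈ B ∧
      gFlow Fq t • tauBar (Matrix.replicateRow (Fin 1) (f x)) ∉ setK Fq ε} ⊆
      {y | y ∈ B ∩ ν.support ∧ ¬ IsMarked ψ ε Set.univ y} ∪ ν.supportᶜ := by
    rintro x ⟨hxB, hx⟩
    by_cases hxs : x ∈ ν.support
    · exact Or.inl ⟨⟨hxB, hxs⟩, fun hmk => hx (flow_smul_tauBar_mem_setK t (f x) fun v hv =>
        RationalSubspace.le_norm_mulVec_of_isMarked (g := fun x => flowMatrix t (f x))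
          hε1' hmk hv)⟩
    · exact Or.inr hxs
  calc _ ≤ ν {y | y ∈ B ∩ ν.support ∧ ¬ IsMarked ψ ε Set.univ y} + ν ν.supportᶜ :=
        (measure_mono hcover).trans (measure_union_le _ _)
    _ ≤ (n + 1 : ℕ) * (ENNReal.ofReal C * ENNReal.ofReal ε ^ α) * ENNReal.ofReal D ^ (n + 1) *
          ν B := by
        rw [Measure.measure_compl_support_of_regular, add_zero]
        exact hmain
    -- The induction yields `D ^ (n + 1)`; the stated exponent is larger, and `1 ≤ D`.
    _ ≤ (n + 1 : ℕ) * (ENNReal.ofReal C * ENNReal.ofReal ε ^ α) *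
          ENNReal.ofReal D ^ (2 * (n + 1)) * ν B := by
        gcongr
        omega
    _ = _ := by
        congr 1
        rw [ENNReal.ofReal_rpow_of_pos hε, ← ENNReal.ofReal_pow hD.le, ← ENNReal.ofReal_natCast,
          ← ENNReal.ofReal_mul hC.le, ← ENNReal.ofReal_mul (by positivity),
          ← ENNReal.ofReal_mul (by positivity)]
        congr 1
        push_cast
        ring
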